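/- Let $M:\mathbb{R}^m\to\mathbb{R}^d$ be a linear map, let $\mathcal{Z}\subset\mathbb{R}^m$ be a compact convex polyhedron (a compact set of the form $\{z\in\mathbb{R}^m : z'a^{(i)}\le b^{(i)},\ i=1,\dots,\ell\}$), and put $\mathcal{W}=\{Mz : z\in\mathcal{Z}\}$ and $\Phi(w)=\{z\in\mathcal{Z} : Mz=w\}$ for $w\in\mathcal{W}$. Let $g:\mathcal{Z}\to\mathbb{R}$ be continuous, and suppose that either (i) $g$ is strictly quasiconvex, that is, $g(\lambda z^{(1)}+(1-\lambda)z^{(2)})<\max\{g(z^{(1)}),g(z^{(2)})\}$ for all $0<\lambda<1$ and all $z^{(1)}\ne z^{(2)}$ in $\mathcal{Z}$, or (ii) $g$ is affine, that is, there are $a\in\mathbb{R}^m$ and $b\in\mathbb{R}$ with $g(z)=z'a+b$ for all $z\in\mathcal{Z}$. For $w\in\mathcal{W}$ let $\check g(w)=\inf\{g(z) : z\in\Phi(w)\}$. Then this infimum is attained for every $w\in\mathcal{W}$, the function $\check g:\mathcal{W}\to\mathbb{R}$ is continuous, and there is a continuous function $\psi:\mathcal{W}\to\mathcal{Z}$ such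 that $\psi(w)\in\Phi(w)$ (that is, $M\psi(w)=w$) and $g(\psi(w))=\check g(w)$ for every $w\in\mathcal{W}$; that is, $\psi$ is a continuous selection from the sets of minimizers $\Psi(w)=\{z\in\Phi(w) : g(z)=\check g(w)\}$. -/

import Mathlib

namespace WorkloadReduction

/-- A convex polyhedron in `ℝ^m`: the solution set `{z : z'a⁽ⁱ⁾ ≤ b⁽ⁱ⁾, i = 1, …, ℓ}` of finitely
many (non-strict) linear inequalities. -/
def IsConvexPolyhedron {m : ℕ} (Z : Set (EuclideanSpace ℝ (Fin m))) : Prop :=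
  ∃ (l : ℕ) (a : Fin l → EuclideanSpace ℝ (Fin m)) (b : Fin l → ℝ),
    Z = {z | ∀ i, inner ℝ (a i) z ≤ b i}

/-- Strict quasiconvexity on `C` (used for convex `C`): `f` is strictly below the larger of the two
end values at every point strictly between two distinct points of `C`. -/
def StrictQuasiconvexOn {m : ℕ} (C : Set (EuclideanSpace ℝ (Fin m)))
    (f : EuclideanSpace ℝ (Fin m) → ℝ) : Prop :=
  ∀ x ∈ C, ∀ y ∈ C, x ≠ y → ∀ t : ℝ, 0 < t → t < 1 →
    f (t • x + (1 - t) • y) < max (f x) (f y)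

/-- `f` is affine on `C`: `f z = z'a + b` for all `z ∈ C`. -/
def IsAffineOn {m : ℕ} (C : Set (EuclideanSpace ℝ (Fin m)))
    (f : EuclideanSpace ℝ (Fin m) → ℝ) : Prop :=
  ∃ (a : EuclideanSpace ℝ (Fin m)) (b : ℝ), ∀ z ∈ C, f z = inner ℝ a z + b

/-- The workload state space `𝒲 = {Mz : z ∈ 𝒵}`. -/
def workloadSpace {m d : ℕ} (M : EuclideanSpace ℝ (Fin m) →ₗ[ℝ] EuclideanSpace ℝ (Fin d))
    (Z : Set (EuclideanSpace ℝ (Fin m))) : Set (EuclideanSpace ℝ (Fin d)) :=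
  M '' Z

/-- The feasible set `Φ(w) = {z ∈ 𝒵 : Mz = w}`. -/
def feasibleSet {m d : ℕ} (M : EuclideanSpace ℝ (Fin m) →ₗ[ℝ] EuclideanSpace ℝ (Fin d))
    (Z : Set (EuclideanSpace ℝ (Fin m))) (w : EuclideanSpace ℝ (Fin d)) :
    Set (EuclideanSpace ℝ (Fin m)) :=
  {z | z ∈ Z ∧ M z = w}

/-- The infimum function (effective cost) `ǧ(w) = inf {g(z) : z ∈ Φ(w)}`, meaningful for `w ∈ 𝒲`. -/
noncomputable def effectiveCost {m d : ℕ}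
    (M : EuclideanSpace ℝ (Fin m) →ₗ[ℝ] EuclideanSpace ℝ (Fin d))
    (Z : Set (EuclideanSpace ℝ (Fin m))) (g : EuclideanSpace ℝ (Fin m) → ℝ)
    (w : EuclideanSpace ℝ (Fin d)) : ℝ :=
  sInf (g '' feasibleSet M Z w)

/-- The set of minimizers `Ψ(w) = {z ∈ Φ(w) : g(z) = ǧ(w)}`. -/
def minimizerSet {m d : ℕ} (M : EuclideanSpace ℝ (Fin m) →ₗ[ℝ] EuclideanSpace ℝ (Fin d))
    (Z : Set (EuclideanSpace ℝ (Fin m))) (g : EuclideanSpace ℝ (Fin m) → ℝ)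
    (w : EuclideanSpace ℝ (Fin d)) : Set (EuclideanSpace ℝ (Fin m)) :=
  {z | z ∈ feasibleSet M Z w ∧ g z = effectiveCost M Z g w}

end WorkloadReduction

open Set Filter Topology

namespace WorkloadReduction

section Fibres

variable {E F ι : Type*} [NormedAddCommGroup E] [NormedSpace ℝ E]
  [NormedAddCommGroup F] [NormedSpace ℝ F]

/-! The crux is lower hemicontinuity of `w ↦ Φ(w)`, where polyhedrality enters
(`exists_uniform_step`, `eventually_exists_mem_fibre`). With compactness of `Z` it makes the minimum
value continuous, and unique minimizers then vary continuously, since every cluster point of them is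
again a minimizer. Strict quasiconvexity gives uniqueness. If `g` is affine with linear part `p`,
its minimizers over `w` form a whole fibre of `(M, p)`; that fibre has a unique point of least norm,
so the unique case applies to the norm and the map `(M, p)`. -/

theorem exists_isLeast_image_fibre {Z : Set E} (hZ : IsCompact Z) (M : E →L[ℝ] F)
    {g : E → ℝ} (hg : ContinuousOn g Z) {w : F} (hw : w ∈ M '' Z) :
    ∃ z, (z ∈ Z ∧ M z = w) ∧ IsLeast (g '' {z | z ∈ Z ∧ M z = w}) (g z) := by
  have hK : IsCompact {z | z ∈ Z ∧ M z = w} :=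
    hZ.inter_right (isClosed_eq M.continuous continuous_const)
  obtain ⟨x, hx, rfl⟩ := hw
  obtain ⟨z, hz, hmin⟩ := hK.exists_isMinOn ⟨x, hx, rfl⟩ (hg.mono fun _ h => h.1)
  exact ⟨z, hz, ⟨z, hz, rfl⟩, by rintro _ ⟨y, hy, rfl⟩; exact hmin hy⟩

/-- A point of a polyhedron can be moved a uniform distance in a direction that points, from a
nearby point of the polyhedron, to another one. -/
theorem exists_uniform_step [Finite ι] (a : ι → E →L[ℝ] ℝ) (b : ι → ℝ) {x y : E}
    (hx : ∀ i, a i x ≤ b i) (hy : ∀ i, a i y ≤ b i) :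
    ∃ t : ℝ, 0 < t ∧ t ≤ 1 ∧ ∀ᶠ z in 𝓝 x, (∀ i, a i z ≤ b i) →
      ∀ i, a i (z + t • (y - x)) ≤ b i := by
  have key : ∀ i, ∀ᶠ t in 𝓝[>] (0 : ℝ), ∀ᶠ z in 𝓝 x, a i z ≤ b i →
      a i (z + t • (y - x)) ≤ b i := by
    intro i
    -- A constraint active at `x` does not increase along `y - x`, so any `t > 0` works; a slack one
    -- survives small `t` by continuity.
    rcases (hx i).eq_or_lt with h | h
    · filter_upwards [self_mem_nhdsWithin] with t ht
      refine Eventually.of_forall fun z hz => ?_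
      have h1 : t * (a i y - a i x) ≤ 0 :=
        mul_nonpos_of_nonneg_of_nonpos (le_of_lt ht) (by linarith [hy i])
      simp only [map_add, map_smul, map_sub, smul_eq_mul]
      linarith
    · have hc : Tendsto (fun t : ℝ => a i (x + t • (y - x))) (𝓝[>] 0) (𝓝 (a i x)) := by
        have : Continuous fun t : ℝ => a i (x + t • (y - x)) := by fun_prop
        simpa using (this.tendsto 0).mono_left nhdsWithin_le_nhds
      filter_upwards [hc.eventually_lt_const h] with t ht
      have hz : Tendsto (fun z => a i (z + t • (y - x))) (𝓝 x) (𝓝 (a i (x + t • (y - x)))) := by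
        have : Continuous fun z => a i (z + t • (y - x)) := by fun_prop
        exact this.tendsto x
      filter_upwards [hz.eventually_lt_const ht] with z hz _ using hz.le
  have h1 : ∀ᶠ t in 𝓝[>] (0 : ℝ), t ≤ 1 :=
    nhdsWithin_le_nhds (eventually_le_nhds one_pos)
  obtain ⟨t, ⟨ht, ht1⟩, ht0⟩ :=
    (((eventually_all.2 key).and h1).and self_mem_nhdsWithin).exists
  exact ⟨t, ht0, ht1, (eventually_all.2 ht).mono fun z hz hzb i => hz i (hzb i)⟩

/-- The fibres over its image of a linear map on a compact polyhedron depend lower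
hemicontinuously on the base point. -/
theorem eventually_exists_mem_fibre [Finite ι] {Z : Set E} (hZ : IsCompact Z)
    (a : ι → E →L[ℝ] ℝ) (b : ι → ℝ) (hab : Z = {z | ∀ i, a i z ≤ b i}) (M : E →L[ℝ] F)
    {x : E} (hx : x ∈ Z) {U : Set E} (hU : U ∈ 𝓝 x) :
    ∀ᶠ w in 𝓝[M '' Z] (M x), ∃ z ∈ Z, M z = w ∧ z ∈ U := by
  -- `f w` will be a point of the fibre over `w` nearest to `x`; the claim becomes `f w → x`.
  have hex : ∀ w : F, ∃ z, w ∈ M '' Z →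
      (z ∈ Z ∧ M z = w) ∧ ∀ y ∈ Z, M y = w → dist z x ≤ dist y x := by
    intro w
    by_cases hw : w ∈ M '' Z
    · obtain ⟨z, hz, hmin⟩ := exists_isLeast_image_fibre hZ M
        (g := fun z => dist z x) (by fun_prop) hw
      exact ⟨z, fun _ => ⟨hz, fun y hy hyw => hmin.2 ⟨y, ⟨hy, hyw⟩, rfl⟩⟩⟩
    · exact ⟨0, fun h => absurd h hw⟩
  choose f hf using hex
  have hmem : ∀ᶠ w in 𝓝[M '' Z] (M x), w ∈ M '' Z := self_mem_nhdsWithin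
  suffices h : Tendsto f (𝓝[M '' Z] (M x)) (𝓝 x) by
    filter_upwards [hmem, h hU] with w hw hwU using ⟨f w, (hf w hw).1.1, (hf w hw).1.2, hwU⟩
  refine hZ.tendsto_nhds_of_unique_mapClusterPt (hmem.mono fun w hw => (hf w hw).1.1) ?_
  intro y hy hcl
  obtain ⟨u, hu, hfu⟩ := mapClusterPt_iff_ultrafilter.1 hcl
  have hmemu : ∀ᶠ v in (u : Filter F), v ∈ M '' Z := hu hmem
  have hMy : M y = M x :=
    tendsto_nhds_unique ((M.continuous.tendsto y).comp hfu)
      (Tendsto.congr' (hmemu.mono fun w hw => (hf w hw).1.2.symm)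
        (tendsto_id.mono_left (hu.trans nhdsWithin_le_nhds)))
  by_contra hne
  obtain ⟨t, ht0, ht1, hstep⟩ := exists_uniform_step a b (x := y) (y := x)
    (by rw [hab] at hy; exact hy) (by rw [hab] at hx; exact hx)
  -- As `M x = M y`, the shifted point stays in the fibre over `w`, so it cannot be nearer to `x`.
  -- In the limit `‖y - x‖ ≤ (1 - t) ‖y - x‖`, which forces `y = x`.
  have hle : ∀ᶠ w in (u : Filter F), dist (f w) x ≤ dist (f w + t • (x - y)) x := by
    filter_upwards [hmemu, hfu hstep] with w hw hs
    refine (hf w hw).2 _ ?_ ?_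
    · have h1 := (hf w hw).1.1
      rw [hab] at h1 ⊢
      exact hs h1
    · simp [hMy, (hf w hw).1.2]
  have hlim : dist y x ≤ dist (y + t • (x - y)) x :=
    le_of_tendsto_of_tendsto (hfu.dist tendsto_const_nhds)
      ((hfu.add tendsto_const_nhds).dist tendsto_const_nhds) hle
  have heq : y + t • (x - y) - x = (1 - t) • (y - x) := by module
  have hpos : 0 < dist y x := dist_pos.2 hne
  rw [dist_eq_norm (y + _), heq, norm_smul, Real.norm_of_nonneg (by linarith),
    ← dist_eq_norm] at hlim
  nlinarith

/-- Lower semicontinuity needs only compactness: sublevel sets of `g` have closed images under `M`.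
Upper semicontinuity follows by moving a minimizer to nearby fibres, by lower hemicontinuity. -/
theorem continuousOn_min_fibre [Finite ι] {Z : Set E} (hZ : IsCompact Z)
    (a : ι → E →L[ℝ] ℝ) (b : ι → ℝ) (hab : Z = {z | ∀ i, a i z ≤ b i}) (M : E →L[ℝ] F)
    {g : E → ℝ} (hg : ContinuousOn g Z) {c : F → ℝ}
    (hc : ∀ w ∈ M '' Z, IsLeast (g '' {z | z ∈ Z ∧ M z = w}) (c w)) :
    ContinuousOn c (M '' Z) := by
  intro w hw
  refine tendsto_order.2 ⟨fun r hr => ?_, fun r hr => ?_⟩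
  · have hK : IsCompact (Z ∩ g ⁻¹' Iic r) :=
      hZ.of_isClosed_subset (hg.preimage_isClosed_of_isClosed hZ.isClosed isClosed_Iic)
        inter_subset_left
    have hwK : w ∉ M '' (Z ∩ g ⁻¹' Iic r) := by
      rintro ⟨z, hz, hzw⟩
      exact (hr.trans_le ((hc w hw).2 ⟨z, ⟨hz.1, hzw⟩, rfl⟩)).not_ge hz.2
    have hopen := (hK.image M.continuous).isClosed.isOpen_compl.mem_nhds hwK
    filter_upwards [nhdsWithin_le_nhds hopen, self_mem_nhdsWithin] with v hv hvW
    obtain ⟨z, hz, hzv⟩ := (hc v hvW).1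
    by_contra! hle
    exact hv ⟨z, ⟨hz.1, by simpa [hzv] using hle⟩, hz.2⟩
  · obtain ⟨z, ⟨hz, rfl⟩, hzw⟩ := (hc w hw).1
    obtain ⟨U, hU, hUr⟩ := mem_nhdsWithin_iff_exists_mem_nhds_inter.1
      ((hg z hz).eventually_lt_const (hzw.trans_lt hr))
    filter_upwards [eventually_exists_mem_fibre hZ a b hab M hz hU, self_mem_nhdsWithin]
      with v ⟨y, hy, hyv, hyU⟩ hvW
    exact ((hc v hvW).2 ⟨y, ⟨hy, hyv⟩, rfl⟩).trans_lt (hUr ⟨hyU, hy⟩)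

/-- If minimizers on the fibres of a linear map on a compact polyhedron are unique, then they
depend continuously on the base point. -/
theorem exists_continuousOn_minimizer [Finite ι] {Z : Set E} (hZ : IsCompact Z)
    (a : ι → E →L[ℝ] ℝ) (b : ι → ℝ) (hab : Z = {z | ∀ i, a i z ≤ b i}) (M : E →L[ℝ] F)
    {g : E → ℝ} (hg : ContinuousOn g Z) {c : F → ℝ}
    (hc : ∀ w ∈ M '' Z, IsLeast (g '' {z | z ∈ Z ∧ M z = w}) (c w))
    (huniq : ∀ x ∈ Z, ∀ y ∈ Z, M x = M y → g x = g y → x ≠ y →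
      ∃ z ∈ Z, M z = M x ∧ g z < g x) :
    ∃ ψ : F → E, ContinuousOn ψ (M '' Z) ∧
      ∀ w ∈ M '' Z, (ψ w ∈ Z ∧ M (ψ w) = w) ∧ g (ψ w) = c w := by
  have hex : ∀ w : F, ∃ z, w ∈ M '' Z → (z ∈ Z ∧ M z = w) ∧ g z = c w := by
    intro w
    by_cases hw : w ∈ M '' Z
    · obtain ⟨z, hz, hzw⟩ := (hc w hw).1
      exact ⟨z, fun _ => ⟨hz, hzw⟩⟩
    · exact ⟨0, fun h => absurd h hw⟩
  choose ψ hψ using hex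
  refine ⟨ψ, fun w hw => ?_, hψ⟩
  have hmem : ∀ᶠ v in 𝓝[M '' Z] w, v ∈ M '' Z := self_mem_nhdsWithin
  refine hZ.tendsto_nhds_of_unique_mapClusterPt (hmem.mono fun v hv => (hψ v hv).1.1) ?_
  intro y hy hcl
  obtain ⟨u, hu, hψu⟩ := mapClusterPt_iff_ultrafilter.1 hcl
  have hmemu : ∀ᶠ v in (u : Filter F), v ∈ M '' Z := hu hmem
  have hMy : M y = w :=
    tendsto_nhds_unique ((M.continuous.tendsto y).comp hψu)
      (Tendsto.congr' (hmemu.mono fun v hv => (hψ v hv).1.2.symm)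
        (tendsto_id.mono_left (hu.trans nhdsWithin_le_nhds)))
  have hψZ : Tendsto ψ u (𝓝[Z] y) :=
    tendsto_nhdsWithin_iff.2 ⟨hψu, hmemu.mono fun v hv => (hψ v hv).1.1⟩
  -- Continuity of the minimum value makes the cluster point `y` a minimizer over `w`.
  have hgy : g y = c w :=
    tendsto_nhds_unique ((hg y hy).tendsto.comp hψZ)
      (Tendsto.congr' (hmemu.mono fun v hv => (hψ v hv).2.symm)
        ((continuousOn_min_fibre hZ a b hab M hg hc w hw).tendsto.mono_left hu))
  by_contra hne
  obtain ⟨⟨h1, h2⟩, h3⟩ := hψ w hw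
  obtain ⟨z, hz, hzM, hzg⟩ := huniq y hy _ h1 (hMy.trans h2.symm) (hgy.trans h3.symm) hne
  exact (hgy ▸ hzg).not_ge ((hc w hw).2 ⟨z, ⟨hz, hzM.trans hMy⟩, rfl⟩)

/-- Continuous selection of minimizers of a continuous linear functional `p`: the minimizer of
least norm is taken. -/
theorem exists_continuousOn_minimizer_of_linear [Finite ι] [StrictConvexSpace ℝ E]
    {Z : Set E} (hZ : IsCompact Z) (a : ι → E →L[ℝ] ℝ) (b : ι → ℝ)
    (hab : Z = {z | ∀ i, a i z ≤ b i}) (hconv : Convex ℝ Z) (M : E →L[ℝ] F)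
    (p : E →L[ℝ] ℝ) {c : F → ℝ}
    (hc : ∀ w ∈ M '' Z, IsLeast (p '' {z | z ∈ Z ∧ M z = w}) (c w)) :
    ∃ ψ : F → E, ContinuousOn ψ (M '' Z) ∧
      ∀ w ∈ M '' Z, (ψ w ∈ Z ∧ M (ψ w) = w) ∧ p (ψ w) = c w := by
  have hcont := continuousOn_min_fibre hZ a b hab M p.continuous.continuousOn hc
  have hmem : ∀ w ∈ M '' Z, (w, c w) ∈ M.prod p '' Z := by
    intro w hw
    obtain ⟨z, ⟨hz, hzM⟩, hzp⟩ := (hc w hw).1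
    exact ⟨z, hz, by simp [hzM, hzp]⟩
  obtain ⟨ψ, hψ, hmin⟩ := exists_continuousOn_minimizer hZ a b hab (M.prod p)
    (g := fun z => ‖z‖) (by fun_prop)
    (c := fun v => sInf ((fun z => ‖z‖) '' {z | z ∈ Z ∧ M.prod p z = v}))
    (by
      intro v hv
      obtain ⟨z, -, hz⟩ := exists_isLeast_image_fibre hZ (M.prod p)
        (g := fun z => ‖z‖) (by fun_prop) hv
      exact hz.csInf_eq ▸ hz)
    -- Strict convexity of the norm: the midpoint of two distinct points of equal norm has smaller
    -- norm.
    (by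
      intro x hx y hy hxy hn hne
      refine ⟨(1 / 2 : ℝ) • x + (1 / 2 : ℝ) • y,
        hconv hx hy (by norm_num) (by norm_num) (by norm_num), ?_,
        norm_combo_lt_of_ne le_rfl hn.ge hne (by norm_num) (by norm_num) (by norm_num)⟩
      rw [map_add, map_smul, map_smul, ← hxy]
      module)
  refine ⟨fun w => ψ (w, c w), hψ.comp (continuousOn_id.prodMk hcont) hmem, fun w hw => ?_⟩
  obtain ⟨⟨h1, h2⟩, -⟩ := hmin _ (hmem w hw)
  have h3 := Prod.ext_iff.1 h2
  exact ⟨⟨h1, h3.1⟩, h3.2⟩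

end Fibres

end WorkloadReduction

theorem lemmaA5 {m d : ℕ}
    (M : EuclideanSpace ℝ (Fin m) →ₗ[ℝ] EuclideanSpace ℝ (Fin d))
    (Z : Set (EuclideanSpace ℝ (Fin m))) (hZc : IsCompact Z)
    (hZp : WorkloadReduction.IsConvexPolyhedron Z)
    (g : EuclideanSpace ℝ (Fin m) → ℝ) (hgc : ContinuousOn g Z)
    (hg : WorkloadReduction.StrictQuasiconvexOn Z g ∨ WorkloadReduction.IsAffineOn Z g) :
    (∀ w ∈ WorkloadReduction.workloadSpace M Z,
      IsLeast (g '' WorkloadReduction.feasibleSet M Z w)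
        (WorkloadReduction.effectiveCost M Z g w)) ∧
    ContinuousOn (WorkloadReduction.effectiveCost M Z g)
      (WorkloadReduction.workloadSpace M Z) ∧
    ∃ ψ : EuclideanSpace ℝ (Fin d) → EuclideanSpace ℝ (Fin m),
      ContinuousOn ψ (WorkloadReduction.workloadSpace M Z) ∧
      ∀ w ∈ WorkloadReduction.workloadSpace M Z,
        ψ w ∈ WorkloadReduction.minimizerSet M Z g w := by

  obtain ⟨l, a, b, hab⟩ := hZp
  set L : EuclideanSpace ℝ (Fin m) →L[ℝ] EuclideanSpace ℝ (Fin d) := M.toContinuousLinearMap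
  have hab' : Z = {z | ∀ i, innerSL ℝ (a i) z ≤ b i} := hab
  have hconv : Convex ℝ Z := by
    rw [hab', ofPred_forall]
    exact convex_iInter fun i => convex_halfSpace_le (innerSL ℝ (a i)).isLinear (b i)
  have hleast : ∀ w ∈ L '' Z, IsLeast (g '' {z | z ∈ Z ∧ L z = w})
      (WorkloadReduction.effectiveCost M Z g w) := by
    intro w hw
    obtain ⟨z, -, hz⟩ := WorkloadReduction.exists_isLeast_image_fibre hZc L hgc hw
    have heq : WorkloadReduction.effectiveCost M Z g w = g z := hz.csInf_eq
    exact heq.symm ▸ hz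
  refine ⟨hleast, WorkloadReduction.continuousOn_min_fibre hZc _ b hab' L hgc hleast, ?_⟩
  rcases hg with hg | ⟨p, q, hpq⟩
  · refine WorkloadReduction.exists_continuousOn_minimizer hZc _ b hab' L hgc hleast ?_
    intro x hx y hy hxy hgxy hne
    refine ⟨(1 / 2 : ℝ) • x + (1 - 1 / 2 : ℝ) • y,
      hconv hx hy (by norm_num) (by norm_num) (by norm_num), ?_, ?_⟩
    · rw [map_add, map_smul, map_smul, ← hxy]
      module
    · simpa [hgxy] using hg x hx y hy hne (1 / 2) (by norm_num) (by norm_num)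
  · obtain ⟨ψ, hψ, hmin⟩ := WorkloadReduction.exists_continuousOn_minimizer_of_linear hZc _ b
      hab' hconv L (innerSL ℝ p)
      -- Removing the constant `q` leaves the minimum of the linear part.
      (c := fun w => WorkloadReduction.effectiveCost M Z g w - q) (by
        intro w hw
        obtain ⟨⟨z, hz, hzw⟩, hlow⟩ := hleast w hw
        refine ⟨⟨z, hz, ?_⟩, ?_⟩
        · rw [← hzw, hpq z hz.1]
          simp
        · rintro _ ⟨y, hy, rfl⟩
          have := hlow ⟨y, hy, rfl⟩
          rw [hpq y hy.1] at this
          simpa using this)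
    refine ⟨ψ, hψ, fun w hw => ⟨(hmin w hw).1, ?_⟩⟩
    have h := (hmin w hw).2
    rw [innerSL_apply_apply] at h
    rw [hpq _ (hmin w hw).1.1, h]
    ring
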